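/- Let $G$ be a group, let $G_1,\ldots,G_k$ be subgroups of $G$ and let $a_1,\ldots,a_k\in G$. Suppose that the left cosets $a_1G_1,\ldots,a_kG_k$ form a nontrivial uniform cover of $G$; that is, the number $|\{1\le i\le k : x\in a_iG_i\}|$ is the same for all $x\in G$, and not all of the $G_i$ are equal to $G$. Let $n_i=[G:G_i]$ be the (finite) indices, and write their least common multiple as $$[n_1,\ldots,n_k]=\prod_{t=1}^r p_t^{\alpha_t},$$ where $p_1,\ldots,p_r$ are distinct primes (in any order) and $\alpha_1,\ldots,\alpha_r$ are positive integers. Let $\mathrm{ord}_{p}n$ denote the exponent of the prime $p$ in $n$, and put $$\beta_r=\min\{1\le\beta\le\alpha_r : \beta=\mathrm{ord}_{p_r}n_i\text{ for some } i=1,\ldots,k\},$$ $$\varepsilon_r=\Bigl(1-\frac1{p_r^{\alpha_r-\beta_r+1}}\Bigr)\prod_{0<t<r}\Bigl(1-\frac1{p_t^{\alpha_t+1}}\Bigr),$$ $$M_r=\max\bigl\{|\{1\le i\le k : n_i=n_j\}| : 1\le j\le k,\ p_r\mid n_j\bigr\}.$$ For a subgroup $H$ of $G$ let $H_G$ denote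 its core, the largest normal subgroup of $G$ contained in $H$. Then $$p_r^{\beta_r}\le\varepsilon_r M_r\prod_{t=1}^r\frac{p_t}{p_t-1},$$ provided that both (a) and (b) below hold, or that $p_1<\cdots<p_r$ and (c) holds. (a) If not all the $G_i$ with $p_r\mid n_i$ are subnormal in $G$, then either $G/(G_i)_G$ is solvable for all $i$ with $p_r\mid n_i$, or $G/(G_i)_G$ is solvable for all $i$ with $p_r\nmid n_i$. (b) For each $i$ with $n_i>p_r$ and $p_r\nmid n_i$, if $G_i$ is not subnormal in $G$, then $G/(G_i)_G$ has a normal Sylow $p_r$-subgroup. (c) The group $\bar G=G/\bigl(\bigcap_{i=1}^kG_i\bigr)_G$ is solvable and has a normal Sylow $p$-subgroup, where $p$ is the largest prime divisor of $|\bar G|$. -/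

import Mathlib

/-- The covering function of a finite system of left cosets `a i • H i` (`i < k`) in a group:
the number of indices `i` for which `x` lies in the left coset `a i • H i`. -/
noncomputable def coverCount {G : Type*} [Group G] {k : ℕ}
    (a : Fin k → G) (H : Fin k → Subgroup G) (x : G) : ℕ :=
  Nat.card {i : Fin k // ∃ h ∈ H i, x = a i * h}

/-- The system of left cosets `a i • H i` covers all elements of the group the same number of
times. -/
def IsUniformCover {G : Type*} [Group G] {k : ℕ}
    (a : Fin k → G) (H : Fin k → Subgroup G) : Prop :=
  ∀ x y : G, coverCount a H x = coverCount a H y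

/-- A nontrivial uniform cover: a uniform cover in which not all the subgroups equal the whole
group. -/
def IsNontrivialUniformCover {G : Type*} [Group G] {k : ℕ}
    (a : Fin k → G) (H : Fin k → Subgroup G) : Prop :=
  IsUniformCover a H ∧ ¬ ∀ i, H i = ⊤

/-- The group `Q` has a normal Sylow `p`-subgroup. -/
def HasNormalSylow (p : ℕ) (Q : Type*) [Group Q] : Prop :=
  ∃ P : Sylow p Q, (P : Subgroup Q).Normal

/-!
Write `p = p r`, let `I` be the set of indices `i` with `p ∣ n i`, where `n i = [G : H i]`, and let
`n' i` be the part of `n i` prime to `p`. Every `n i` with `i ∈ I` is `d * p ^ b` with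
`β ≤ b ≤ α r` and `d` among the values of `n'`, and occurs at most `M` times. Hence
`∑ i ∈ I, 1 / n i ≤ M * (∑ d, 1 / d) * (∑ b, 1 / p ^ b)`, with `d` running over the distinct values
of `n'` (`sum_inv_le_mul_sum_ordCompl`). With `N = ∏ t < r, p t ^ α t` and `σ = ∑ e ∣ N, 1 / e`, the
theorem is the inequality `1 ≤ M * σ * ∑ b, 1 / p ^ b`, so it is enough to show that
`∑ i ∈ I, 1 / n i ≥ (∑ d, 1 / d) / σ`.

Let `L` be the intersection of the cores of the `H i` with `i ∉ I`. The hypotheses give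
`p ∤ [G : L]`: subnormal subgroups of index prime to `p`, subgroups of index less than `p`, and
subgroups whose core quotient has a normal Sylow `p`-subgroup all have cores of index prime to `p`.
The cosets outside `I` cover `x` and `x * l` equally often for `l ∈ L`. Since the cover is uniform,
the union `U` of the cosets in `I` is stable under `L`; hence it is the union of the cosets
`a i • (H i ⊔ L)`, and the index of `H i ⊔ L` divides `n' i`. By the union bound
`∑ i ∈ I, 1 / n i` is at least the density of `U`, so what remains is a lower bound for the density
of a union of cosets.

That bound is `card_mul_recipDivisorSum_le_card_iUnion_coset`, an analogue of Rogers' theorem. In a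
finite group, if the subgroups are all subnormal, or all contain a common term of the derived series,
then the density of the union of one coset of each is at least
`(∑ 1 / e) / σ`, where `e` runs over the divisors of `N` divisible by one of the indices. The proof is
by induction on the order: there is a proper normal subgroup `M` such that every subgroup either
lies in `M` or supplements it. A coset of a subgroup in `M` lies in one coset of `M`, where its
index drops by the factor `[G : M]`, while a coset of a supplement meets each coset of `M`, with
unchanged index. Averaging over the cosets of `M` reduces the claim to
`card_mul_recipDivisorSum_le`, which holds because dividing by `[G : M]` is injective on multiples.
-/

/-! ### Sums of reciprocals of divisors -/

/-- The sum of the reciprocals `1 / e` over the divisors `e` of `N` that lie in `A`. -/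
noncomputable def recipDivisorSum (N : ℕ) (A : Set ℕ) : ℝ :=
  ∑ e ∈ N.divisors, A.indicator (fun e => (e : ℝ)⁻¹) e

theorem recipDivisorSum_eq_sum_filter (N : ℕ) (A : Set ℕ) [DecidablePred (· ∈ A)] :
    recipDivisorSum N A = ∑ e ∈ N.divisors with e ∈ A, (e : ℝ)⁻¹ := by
  simp [recipDivisorSum, Finset.sum_filter, Set.indicator_apply]

theorem recipDivisorSum_mono (N : ℕ) {A B : Set ℕ} (h : A ⊆ B) :
    recipDivisorSum N A ≤ recipDivisorSum N B :=
  Finset.sum_le_sum fun _ _ =>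
    Set.indicator_le_indicator_of_subset h (fun _ => by positivity) _

theorem recipDivisorSum_empty (N : ℕ) : recipDivisorSum N ∅ = 0 := by
  simp [recipDivisorSum]

theorem recipDivisorSum_union_eq (N : ℕ) (A B : Set ℕ) :
    recipDivisorSum N (A ∪ B) = recipDivisorSum N A + recipDivisorSum N (B \ A) := by
  unfold recipDivisorSum
  rw [← Finset.sum_add_distrib, ← Set.union_sdiff_self,
    Set.indicator_union_of_disjoint Set.disjoint_sdiff_right]

theorem recipDivisorSum_iUnion_le {κ : Type*} [Fintype κ] (N : ℕ) (A : κ → Set ℕ) :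
    recipDivisorSum N (⋃ c, A c) ≤ ∑ c, recipDivisorSum N (A c) := by
  unfold recipDivisorSum
  rw [Finset.sum_comm]
  refine Finset.sum_le_sum fun e _ => ?_
  have h0 : ∀ c ∈ Finset.univ, 0 ≤ (A c).indicator (fun e : ℕ => (e : ℝ)⁻¹) e :=
    fun c _ => Set.indicator_nonneg (fun _ _ => by positivity) _
  by_cases he : e ∈ ⋃ c, A c
  · obtain ⟨c, hc⟩ := Set.mem_iUnion.1 he
    rw [Set.indicator_of_mem he, ← Set.indicator_of_mem hc (fun e : ℕ => (e : ℝ)⁻¹)]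
    exact Finset.single_le_sum h0 (Finset.mem_univ c)
  · rw [Set.indicator_of_notMem he]
    exact Finset.sum_nonneg h0

/-- If `S` is stable under multiplication by `q`, then dividing by `q` carries the divisors of `N`
in `q T \ S` injectively to divisors in `T \ S`, and multiplies reciprocals by `q`. -/
theorem mul_recipDivisorSum_image_diff_le (N q : ℕ) (hq : 0 < q) (S T : Set ℕ)
    (hS : ∀ e ∈ S, q * e ∈ S) :
    q * recipDivisorSum N (((q * ·) '' T) \ S) ≤ recipDivisorSum N (T \ S) := by
  classical
  have hq' : (q : ℝ) ≠ 0 := by positivity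
  have h1 : recipDivisorSum N (((q * ·) '' T) \ S) ≤
      ∑ e ∈ (N.divisors.filter (· ∈ T \ S)).image (q * ·), (e : ℝ)⁻¹ := by
    rw [recipDivisorSum_eq_sum_filter]
    refine Finset.sum_le_sum_of_subset_of_nonneg ?_ fun _ _ _ => by positivity
    intro e he
    simp only [Finset.mem_filter, Nat.mem_divisors, Set.mem_sdiff, Set.mem_image] at he
    obtain ⟨⟨hd, hN⟩, ⟨z, hz, rfl⟩, heS⟩ := he
    refine Finset.mem_image.2 ⟨z, ?_, rfl⟩
    simp only [Finset.mem_filter, Nat.mem_divisors, Set.mem_sdiff]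
    exact ⟨⟨(Dvd.intro_left q rfl).trans hd, hN⟩, hz, fun h => heS (hS z h)⟩
  refine (mul_le_mul_of_nonneg_left h1 (by positivity)).trans_eq ?_
  rw [Finset.sum_image (fun x _ y _ h => Nat.eq_of_mul_eq_mul_left hq h), Finset.mul_sum,
    recipDivisorSum_eq_sum_filter]
  refine Finset.sum_congr rfl fun e _ => ?_
  push_cast
  rw [mul_inv, mul_inv_cancel_left₀ hq']

theorem card_mul_recipDivisorSum_le {κ : Type*} [Fintype κ] [Nonempty κ] (N : ℕ) (S : Set ℕ)
    (T : κ → Set ℕ) (hS : ∀ e ∈ S, Fintype.card κ * e ∈ S) :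
    Fintype.card κ * recipDivisorSum N (S ∪ ⋃ c, (Fintype.card κ * ·) '' T c) ≤
      ∑ c, recipDivisorSum N (S ∪ T c) := by
  set q := Fintype.card κ with hq
  have hq0 : 0 < q := Fintype.card_pos
  simp only [recipDivisorSum_union_eq, Finset.sum_add_distrib, Finset.sum_const,
    Finset.card_univ, nsmul_eq_mul, mul_add, Set.iUnion_sdiff]
  refine add_le_add le_rfl ?_
  calc _ ≤ (q : ℝ) * ∑ c, recipDivisorSum N (((q * ·) '' T c) \ S) :=
        mul_le_mul_of_nonneg_left (recipDivisorSum_iUnion_le _ _) (by positivity)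
    _ = ∑ c, q * recipDivisorSum N (((q * ·) '' T c) \ S) := Finset.mul_sum _ _ _
    _ ≤ _ := Finset.sum_le_sum fun c _ => mul_recipDivisorSum_image_diff_le N q hq0 S (T c) hS

/-! ### Unions of cosets in a finite group -/

/-- A normal subgroup maximal among the proper normal subgroups containing `C` serves every `H`
for which each proper `H ⊔ M` lies in a proper normal subgroup. -/
theorem exists_normal_le_or_sup_eq_top {G : Type*} [Group G] [Finite G] (𝓗 : Set (Subgroup G))
    (C : Subgroup G) (hCn : C.Normal) (hC : C ≠ ⊤)
    (h : ∀ H ∈ 𝓗, ∀ M : Subgroup G, M.Normal → C ≤ M → H ⊔ M ≠ ⊤ →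
      ∃ K : Subgroup G, K.Normal ∧ H ⊔ M ≤ K ∧ K ≠ ⊤) :
    ∃ M : Subgroup G, M.Normal ∧ M ≠ ⊤ ∧ ∀ H ∈ 𝓗, H ≤ M ∨ H ⊔ M = ⊤ := by
  obtain ⟨M, hCM, hM⟩ := (Set.toFinite {M : Subgroup G | M.Normal ∧ M ≠ ⊤}).exists_le_maximal
    (show C ∈ {M : Subgroup G | M.Normal ∧ M ≠ ⊤} from ⟨hCn, hC⟩)
  refine ⟨M, hM.prop.1, hM.prop.2, fun H hH => or_iff_not_imp_right.2 fun hHM => ?_⟩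
  obtain ⟨K, hKn, hK, hKt⟩ := h H hH M hM.prop.1 hCM hHM
  exact le_sup_left.trans (hK.trans (hM.le_of_ge ⟨hKn, hKt⟩ (le_sup_right.trans hK)))

/-- The hypothesis on a family of subgroups under which unions of their cosets cannot be small:
all of them are subnormal, or all of them contain a common term of the derived series. -/
def SubnormalOrDerived {G ι : Type*} [Group G] (J : Finset ι) (H : ι → Subgroup G) : Prop :=
  (∀ i ∈ J, (H i).IsSubnormal) ∨ ∃ n, ∀ i ∈ J, derivedSeries G n ≤ H i

theorem SubnormalOrDerived.subgroupOf {G ι : Type*} [Group G] {J J' : Finset ι}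
    {H : ι → Subgroup G} (h : SubnormalOrDerived J H) (hJ : J' ⊆ J) (M : Subgroup G) :
    SubnormalOrDerived J' (fun i => (H i).subgroupOf M) := by
  refine h.imp (fun h i hi => (h i (hJ hi)).subgroupOf) ?_
  rintro ⟨n, hn⟩
  exact ⟨n, fun i hi => Subgroup.map_le_iff_le_comap.1
    ((map_derivedSeries_le_derivedSeries M.subtype n).trans (hn i (hJ hi)))⟩

theorem Subgroup.IsSubnormal.sup_normal {G : Type*} [Group G] {H : Subgroup G}
    (hH : H.IsSubnormal) (M : Subgroup G) [M.Normal] : (H ⊔ M).IsSubnormal := by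
  have := (hH.quotient (K := M)).comap (QuotientGroup.mk' M)
  rwa [Subgroup.comap_map_eq, QuotientGroup.ker_mk'] at this

theorem SubnormalOrDerived.exists_normal {G ι : Type*} [Group G] [Finite G] {J : Finset ι}
    {H : ι → Subgroup G} (h : SubnormalOrDerived J H) (hne : ∃ i ∈ J, H i ≠ ⊤) :
    ∃ M : Subgroup G, M.Normal ∧ M ≠ ⊤ ∧ ∀ i ∈ J, H i ≤ M ∨ H i ⊔ M = ⊤ := by
  obtain ⟨i₀, hi₀, hne⟩ := hne
  suffices ∃ M : Subgroup G, M.Normal ∧ M ≠ ⊤ ∧ ∀ K ∈ H '' J, K ≤ M ∨ K ⊔ M = ⊤ by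
    obtain ⟨M, hM, hM', hall⟩ := this
    exact ⟨M, hM, hM', fun i hi => hall _ ⟨i, hi, rfl⟩⟩
  rcases h with h | ⟨n, hn⟩
  · refine exists_normal_le_or_sup_eq_top _ ⊥ inferInstance
      (fun hb => hne (top_le_iff.1 (hb ▸ bot_le))) ?_
    rintro _ ⟨i, hi, rfl⟩ M hM - hHM
    obtain ⟨K, hK, hle, hlt⟩ := ((h i hi).sup_normal M).exists_normal_and_le_and_lt_top_of_ne hHM
    exact ⟨K, hK, hle, hlt.ne⟩
  · refine exists_normal_le_or_sup_eq_top _ (commutator G) inferInstance (fun hc => ?_) ?_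
    · refine hne (top_le_iff.1 (le_trans (le_of_eq ?_) (hn i₀ hi₀)))
      clear hn
      induction n with
      | zero => simp
      | succ n ih => rw [derivedSeries_succ, ← ih]; exact hc.symm
    · rintro _ ⟨i, hi, rfl⟩ M hM hCM hHM
      exact ⟨_, Subgroup.Normal.of_commutator_le G (hCM.trans le_sup_right), le_rfl, hHM⟩

/-- Counting a set in a group coset by coset. -/
theorem Subgroup.card_eq_sum_card_out_mul {G : Type*} [Group G] [Finite G] (M : Subgroup G)
    [Fintype (G ⧸ M)] (U : Set G) :
    Nat.card U = ∑ c : G ⧸ M, Nat.card {m : M | c.out * m ∈ U} := by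
  classical
  rw [← Nat.card_sigma]
  refine Nat.card_congr (Equiv.symm (Equiv.ofBijective
    (fun s : (Σ c : G ⧸ M, {m : M | c.out * m ∈ U}) => (⟨s.1.out * s.2.1, s.2.2⟩ : U)) ⟨?_, ?_⟩))
  · rintro ⟨c, m, hm⟩ ⟨c', m', hm'⟩ h
    simp only [Subtype.mk.injEq] at h
    have hc : c = c' := by
      have := congrArg (QuotientGroup.mk : G → G ⧸ M) h
      simpa [QuotientGroup.mk_mul_of_mem] using this
    subst hc
    obtain rfl : m = m' := Subtype.ext (mul_left_cancel h)
    rfl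
  · rintro ⟨g, hg⟩
    have hm : (g : G ⧸ M).out⁻¹ * g ∈ M := QuotientGroup.eq.1 (by simp)
    exact ⟨⟨g, ⟨⟨_, hm⟩, by simpa using hg⟩⟩, by simp⟩

theorem Subgroup.relIndex_mul_index_comm {G : Type*} [Group G] (H K : Subgroup G) :
    H.relIndex K * K.index = K.relIndex H * H.index := by
  rw [← Subgroup.inf_relIndex_left K H, ← Subgroup.inf_relIndex_right K H,
    Subgroup.relIndex_mul_index inf_le_left, Subgroup.relIndex_mul_index inf_le_right]

/-- A group analogue of Rogers' theorem on unions of residue classes, in which the density of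
the multiples of the moduli is replaced by their share in the reciprocal sum over the divisors of
an arbitrary `N`. -/
theorem card_mul_recipDivisorSum_le_card_iUnion_coset {ι : Type*} (N : ℕ) {G : Type*} [Group G]
    [Finite G] (J : Finset ι) (a : ι → G) (H : ι → Subgroup G) (hJ : SubnormalOrDerived J H) :
    Nat.card G * recipDivisorSum N {e | ∃ i ∈ J, (H i).index ∣ e} ≤
      Nat.card {x | ∃ i ∈ J, (a i)⁻¹ * x ∈ H i} * recipDivisorSum N Set.univ := by
  classical
  induction hn : Nat.card G using Nat.strong_induction_on generalizing G J with
  | _ n ih =>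
  subst hn
  by_cases hne : ∃ i ∈ J, H i ≠ ⊤
  swap
  · push Not at hne
    rcases J.eq_empty_or_nonempty with rfl | ⟨i, hi⟩
    · simp [recipDivisorSum_empty]
    · have : {x | ∃ i ∈ J, (a i)⁻¹ * x ∈ H i} = Set.univ :=
        Set.eq_univ_of_forall fun x => ⟨i, hi, by simp [hne i hi]⟩
      rw [this, Nat.card_univ]
      exact mul_le_mul_of_nonneg_left (recipDivisorSum_mono N (Set.subset_univ _)) (by positivity)
  obtain ⟨M, hMn, hMt, hM⟩ := hJ.exists_normal hne
  have : Fintype (G ⧸ M) := Fintype.ofFinite _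
  set U : Set G := {x | ∃ i ∈ J, (a i)⁻¹ * x ∈ H i} with hU
  let S : Set ℕ := {e | ∃ i ∈ J, H i ⊔ M = ⊤ ∧ (H i).index ∣ e}
  let T : G ⧸ M → Set ℕ := fun c => {e | ∃ i ∈ J, H i ≤ M ∧ (a i : G ⧸ M) = c ∧
    (H i).relIndex M ∣ e}
  have hidx : Fintype.card (G ⧸ M) = M.index := by
    rw [Subgroup.index, Nat.card_eq_fintype_card]
  have hcard : Nat.card M < Nat.card G := by
    refine lt_of_le_of_ne (Subgroup.card_le_card_group M) fun h => hMt ?_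
    exact Subgroup.eq_top_of_card_eq M h
  -- The subgroups with `H i ≤ M` meet a single coset of `M`, where their index drops by the
  -- factor `M.index`; the others meet every coset of `M`, where they keep their index.
  have key : ∀ c : G ⧸ M, Nat.card M * recipDivisorSum N (S ∪ T c) ≤
      Nat.card {m : M | c.out * m ∈ U} * recipDivisorSum N Set.univ := by
    intro c
    let J' := J.filter fun i => ∃ m : M, (a i)⁻¹ * (c.out * m) ∈ H i
    have hg : ∀ i, ∃ g : M, i ∈ J' → (a i)⁻¹ * (c.out * g) ∈ H i := by
      intro i
      by_cases hi : i ∈ J'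
      · exact (Finset.mem_filter.1 hi).2.imp fun _ h _ => h
      · exact ⟨1, fun h => absurd h hi⟩
    choose g hg using hg
    have h1 := ih (Nat.card M) hcard J' g (fun i => (H i).subgroupOf M)
      (hJ.subgroupOf (Finset.filter_subset _ _) M) rfl
    have h2 : {m : M | ∃ i ∈ J', (g i)⁻¹ * m ∈ (H i).subgroupOf M} =
        {m : M | c.out * m ∈ U} := by
      ext m
      simp only [Set.mem_ofPred_eq, hU, Subgroup.mem_subgroupOf]
      constructor
      · rintro ⟨i, hi, h⟩
        refine ⟨i, (Finset.mem_filter.1 hi).1, ?_⟩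
        have := (H i).mul_mem (hg i hi) h
        simpa [mul_assoc] using this
      · rintro ⟨i, hi, h⟩
        have hi' : i ∈ J' := Finset.mem_filter.2 ⟨hi, m, h⟩
        refine ⟨i, hi', ?_⟩
        have := (H i).mul_mem ((H i).inv_mem (hg i hi')) h
        simpa [mul_assoc] using this
    rw [h2] at h1
    refine le_trans (mul_le_mul_of_nonneg_left (recipDivisorSum_mono N ?_) (by positivity)) h1
    rintro e (⟨i, hi, hs, he⟩ | ⟨i, hi, hle, hc, he⟩)
    · refine ⟨i, Finset.mem_filter.2 ⟨hi, ?_⟩, ?_⟩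
      · have : (c.out)⁻¹ * a i ∈ M ⊔ H i := by rw [sup_comm, hs]; trivial
        obtain ⟨m, hm, h, hh, hmh⟩ := Subgroup.mem_sup_of_normal_left.1 this
        refine ⟨⟨m, hm⟩, ?_⟩
        have : (a i)⁻¹ * (c.out * m) = h⁻¹ := by
          rw [eq_inv_iff_mul_eq_one, mul_assoc, mul_assoc, hmh]; group
        rw [this]
        exact (H i).inv_mem hh
      · have : (H i).relIndex M ∣ (H i).index := by
          have h4 := Subgroup.relIndex_mul_index_comm M (H i)
          have h5 : M.relIndex (H i) = M.index := by
            rw [← Subgroup.relIndex_sup_right, hs, Subgroup.relIndex_top_right]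
          rw [h5, mul_comm] at h4
          exact (Nat.eq_of_mul_eq_mul_right (Nat.pos_of_ne_zero
            Subgroup.FiniteIndex.index_ne_zero) h4).symm.dvd
        exact this.trans he
    · refine ⟨i, Finset.mem_filter.2 ⟨hi, ⟨⟨_, QuotientGroup.eq.1 ((c.out_eq').trans hc.symm)⟩,
        by simp⟩⟩, he⟩
  have hS : ∀ e ∈ S, Fintype.card (G ⧸ M) * e ∈ S := by
    rintro e ⟨i, hi, hs, he⟩
    exact ⟨i, hi, hs, he.mul_left _⟩
  have hsub : {e | ∃ i ∈ J, (H i).index ∣ e} ⊆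
      S ∪ ⋃ c, (Fintype.card (G ⧸ M) * ·) '' T c := by
    rintro e ⟨i, hi, he⟩
    rcases hM i hi with h | h
    · rw [← Subgroup.relIndex_mul_index h] at he
      obtain ⟨z, rfl⟩ := he
      refine Or.inr (Set.mem_iUnion.2 ⟨(a i : G ⧸ M), (H i).relIndex M * z,
        ⟨i, hi, h, rfl, Dvd.intro _ rfl⟩, ?_⟩)
      simp only [hidx]
      ring
    · exact Or.inl ⟨i, hi, h, he⟩
  have hGM : (Nat.card G : ℝ) = Nat.card M * Fintype.card (G ⧸ M) := by
    rw [hidx]; exact_mod_cast M.card_mul_index.symm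
  calc (Nat.card G : ℝ) * recipDivisorSum N {e | ∃ i ∈ J, (H i).index ∣ e}
      ≤ Nat.card M * (Fintype.card (G ⧸ M) *
          recipDivisorSum N (S ∪ ⋃ c, (Fintype.card (G ⧸ M) * ·) '' T c)) := by
        rw [hGM, mul_assoc]
        gcongr
        exact recipDivisorSum_mono N hsub
    _ ≤ Nat.card M * ∑ c, recipDivisorSum N (S ∪ T c) := by
        gcongr
        exact card_mul_recipDivisorSum_le N S T hS
    _ = ∑ c, Nat.card M * recipDivisorSum N (S ∪ T c) := Finset.mul_sum _ _ _
    _ ≤ ∑ c : G ⧸ M, Nat.card {m : M | c.out * m ∈ U} * recipDivisorSum N Set.univ :=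
        Finset.sum_le_sum fun c _ => key c
    _ = _ := by
        rw [← Finset.sum_mul, M.card_eq_sum_card_out_mul U]
        push_cast
        rfl

/-! ### Normal subgroups of index prime to `p` -/

theorem Subgroup.mem_of_pow_mem_of_not_dvd_index {G : Type*} [Group G] {p : ℕ} (hp : p.Prime)
    (L : Subgroup G) [L.Normal] (hL : ¬ p ∣ L.index) {x : G} (hx : x ^ p ∈ L) : x ∈ L := by
  rw [← QuotientGroup.eq_one_iff] at hx ⊢
  have h1 : (x : G ⧸ L) ^ L.index = 1 := by
    rw [← QuotientGroup.mk_pow, QuotientGroup.eq_one_iff]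
    exact L.pow_index_mem x
  have h2 := pow_gcd_eq_one.2 ⟨hx, h1⟩
  rwa [(hp.coprime_iff_not_dvd.2 hL : Nat.gcd p L.index = 1), pow_one] at h2

theorem Subgroup.IsSubnormal.mem_of_pow_mem {G : Type*} [Group G] {p : ℕ} (hp : p.Prime)
    {H : Subgroup G} (hH : H.IsSubnormal) (hHp : ¬ p ∣ H.index) {x : G} (hx : x ^ p ∈ H) :
    x ∈ H := by
  induction hH with
  | top => trivial
  | step H K hle _ hN ih =>
    rw [← Subgroup.relIndex_mul_index hle] at hHp
    have hxK : x ∈ K := ih (fun h => hHp (h.mul_left _)) (hle hx)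
    exact Subgroup.mem_subgroupOf.1 (Subgroup.mem_of_pow_mem_of_not_dvd_index hp (H.subgroupOf K)
      (fun h => hHp (h.mul_right _)) (x := ⟨x, hxK⟩) (Subgroup.mem_subgroupOf.2 (by simpa using hx)))

theorem Subgroup.not_dvd_index_of_forall_pow_mem {G : Type*} [Group G] {p : ℕ} (hp : p.Prime)
    (L : Subgroup G) [L.Normal] [L.FiniteIndex] (hL : ∀ x, x ^ p ∈ L → x ∈ L) :
    ¬ p ∣ L.index := by
  intro hd
  have := Fact.mk hp
  obtain ⟨y, hy⟩ := exists_prime_orderOf_dvd_card' (G := G ⧸ L) p hd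
  obtain ⟨x, rfl⟩ := QuotientGroup.mk_surjective y
  have hx : x ∈ L := hL x (by
    rw [← QuotientGroup.eq_one_iff, QuotientGroup.mk_pow, ← hy, pow_orderOf_eq_one])
  rw [(QuotientGroup.eq_one_iff x).2 hx, orderOf_one] at hy
  exact hp.one_lt.ne hy

theorem Subgroup.IsSubnormal.not_dvd_index_normalCore {G : Type*} [Group G] {p : ℕ}
    (hp : p.Prime) {H : Subgroup G} [H.FiniteIndex] (hH : H.IsSubnormal) (hHp : ¬ p ∣ H.index) :
    ¬ p ∣ H.normalCore.index := by
  refine Subgroup.not_dvd_index_of_forall_pow_mem hp _ fun x hx g => ?_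
  refine hH.mem_of_pow_mem hp hHp ?_
  rw [conj_pow]
  exact hx g

theorem Subgroup.not_dvd_index_normalCore_of_index_lt {G : Type*} [Group G] {p : ℕ}
    (hp : p.Prime) {H : Subgroup G} [H.FiniteIndex] (hH : H.index < p) :
    ¬ p ∣ H.normalCore.index := by
  intro h
  have h1 : H.normalCore.index ∣ H.index.factorial := by
    rw [Subgroup.normalCore_eq_ker, Subgroup.index_ker, Subgroup.index, ← Nat.card_perm]
    exact Subgroup.card_subgroup_dvd_card _
  exact hH.not_ge ((hp.dvd_factorial).1 (h.trans h1))

/-- The preimage of a normal Sylow subgroup of `G ⧸ N` is contained in every subgroup above `N`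
of index prime to `p`. -/
theorem HasNormalSylow.exists_normal {G : Type*} [Group G] {p : ℕ} (hp : p.Prime)
    (N : Subgroup G) [N.Normal] [N.FiniteIndex] (h : HasNormalSylow p (G ⧸ N)) :
    ∃ P : Subgroup G, P.Normal ∧ ¬ p ∣ P.index ∧
      ∀ H : Subgroup G, N ≤ H → ¬ p ∣ H.index → P ≤ H := by
  have := Fact.mk hp
  obtain ⟨S, hS⟩ := h
  have hsurj := QuotientGroup.mk'_surjective N
  refine ⟨(S : Subgroup (G ⧸ N)).comap (QuotientGroup.mk' N), hS.comap _, ?_, fun H hNH hHp => ?_⟩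
  · rw [Subgroup.index_comap_of_surjective _ hsurj]
    exact S.not_dvd_index
  · set K := H.map (QuotientGroup.mk' N)
    have hK : K.index = H.index :=
      Subgroup.index_map_eq _ hsurj (by rwa [QuotientGroup.ker_mk'])
    have hHK : K.comap (QuotientGroup.mk' N) = H := by
      rw [Subgroup.comap_map_eq, QuotientGroup.ker_mk', sup_eq_left.2 hNH]
    suffices (S : Subgroup (G ⧸ N)) ≤ K from hHK ▸ Subgroup.comap_mono this
    rw [← Subgroup.relIndex_eq_one]
    have h1 : ¬ p ∣ K.relIndex S := by
      intro hd
      have h2 : p ∣ (S : Subgroup (G ⧸ N)).relIndex K * K.index := by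
        rw [Subgroup.relIndex_mul_index_comm]
        exact hd.mul_right _
      rcases hp.dvd_mul.1 h2 with h3 | h3
      · exact S.not_dvd_index (h3.trans (Subgroup.relIndex_dvd_index_of_normal _ _))
      · exact hHp (hK ▸ h3)
    obtain ⟨n, hn⟩ := IsPGroup.iff_card.1 S.isPGroup'
    have h4 : K.relIndex S ∣ p ^ n := hn ▸ Subgroup.relIndex_dvd_card _ _
    exact Nat.Coprime.eq_one_of_dvd
      (Nat.Coprime.pow_right n ((hp.coprime_iff_not_dvd.2 h1).symm)) h4

theorem HasNormalSylow.not_dvd_index_normalCore {G : Type*} [Group G] {p : ℕ} (hp : p.Prime)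
    {N : Subgroup G} [N.Normal] [N.FiniteIndex] (h : HasNormalSylow p (G ⧸ N)) {H : Subgroup G}
    (hN : N ≤ H) (hH : ¬ p ∣ H.index) : ¬ p ∣ H.normalCore.index := by
  obtain ⟨P, hPn, hPp, hP⟩ := h.exists_normal hp N
  exact fun hd => hPp (hd.trans (Subgroup.index_dvd_of_le
    (Subgroup.normal_le_normalCore.2 (hP H hN hH))))

theorem Subgroup.not_dvd_index_iInf {G κ : Type*} [Group G] [Finite κ] {p : ℕ} (hp : p.Prime)
    (L : κ → Subgroup G) (hn : ∀ j, (L j).Normal) (hL : ∀ j, ¬ p ∣ (L j).index) :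
    ¬ p ∣ (⨅ j, L j).index := by
  have : (⨅ j, L j).Normal := Subgroup.normal_iInf_normal hn
  have : (⨅ j, L j).FiniteIndex :=
    Subgroup.finiteIndex_iInf fun j => ⟨fun h => hL j (h ▸ dvd_zero p)⟩
  refine Subgroup.not_dvd_index_of_forall_pow_mem hp _ fun x hx => ?_
  rw [Subgroup.mem_iInf] at hx ⊢
  exact fun j => (L j).mem_of_pow_mem_of_not_dvd_index hp (hL j) (hx j)

theorem Group.IsSolvable.exists_derivedSeries_le {G : Type*} [Group G] (K : Subgroup G)
    [K.Normal] (h : Group.IsSolvable (G ⧸ K)) : ∃ n, derivedSeries G n ≤ K := by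
  obtain ⟨n, hn⟩ := h.solvable
  refine ⟨n, ?_⟩
  have := map_derivedSeries_le_derivedSeries (QuotientGroup.mk' K) n
  rw [hn, le_bot_iff, Subgroup.map_eq_bot_iff, QuotientGroup.ker_mk'] at this
  exact this

theorem exists_forall_derivedSeries_le {G ι : Type*} [Group G] [Finite ι] (P : ι → Prop)
    (K : ι → Subgroup G) (h : ∀ i, P i → ∃ n, derivedSeries G n ≤ K i) :
    ∃ n, ∀ i, P i → derivedSeries G n ≤ K i := by
  have h' : ∀ i, ∃ n, P i → derivedSeries G n ≤ K i := fun i => by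
    by_cases hi : P i
    · exact (h i hi).imp fun _ h _ => h
    · exact ⟨0, fun h => absurd h hi⟩
  choose n hn using h'
  obtain ⟨B, hB⟩ := (Set.finite_range n).bddAbove
  exact ⟨B, fun i hi => (derivedSeries_antitone G (hB ⟨i, rfl⟩)).trans (hn i hi)⟩

/-! ### A lower bound for the sum of the reciprocal indices -/

theorem SubnormalOrDerived.map {G G' ι : Type*} [Group G] [Group G'] {J : Finset ι}
    {H : ι → Subgroup G} (h : SubnormalOrDerived J H) {f : G →* G'}
    (hf : Function.Surjective f) : SubnormalOrDerived J (fun i => (H i).map f) :=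
  h.imp (fun h i hi => (h i hi).map hf) fun ⟨n, hn⟩ =>
    ⟨n, fun i hi => (map_derivedSeries_eq hf n).symm.trans_le (Subgroup.map_mono (hn i hi))⟩

theorem card_iUnion_coset_le {ι G : Type*} [Group G] [Finite G] (J : Finset ι) (a : ι → G)
    (H : ι → Subgroup G) :
    (Nat.card {x | ∃ i ∈ J, (a i)⁻¹ * x ∈ H i} : ℝ) ≤
      Nat.card G * ∑ i ∈ J, ((H i).index : ℝ)⁻¹ := by
  classical
  have := Fintype.ofFinite G
  have h1 : Nat.card {x | ∃ i ∈ J, (a i)⁻¹ * x ∈ H i} ≤ ∑ i ∈ J, Nat.card (H i) := by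
    calc _ = (J.biUnion fun i => Finset.univ.filter fun x => (a i)⁻¹ * x ∈ H i).card := by
          rw [Nat.card_eq_fintype_card, Fintype.card_of_subtype]
          intro x
          simp
      _ ≤ ∑ i ∈ J, (Finset.univ.filter fun x => (a i)⁻¹ * x ∈ H i).card :=
          Finset.card_biUnion_le
      _ = _ := by
          refine Finset.sum_congr rfl fun i _ => ?_
          rw [← Fintype.card_subtype, ← Nat.card_eq_fintype_card]
          exact Nat.card_congr ((Equiv.mulLeft (a i)⁻¹).subtypeEquiv fun x => Iff.rfl)
  rw [Finset.mul_sum]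
  refine (Nat.cast_le.2 h1).trans_eq ?_
  push_cast
  refine Finset.sum_congr rfl fun i _ => ?_
  rw [← (H i).card_mul_index]
  have : ((H i).index : ℝ) ≠ 0 := Nat.cast_ne_zero.2 Subgroup.FiniteIndex.index_ne_zero
  push_cast
  rw [mul_inv_cancel_right₀ this]

theorem recipDivisorSum_le_sum_inv_index_of_finite {ι G : Type*} [Group G] [Finite G] (N : ℕ)
    (J : Finset ι) (a : ι → G) (H : ι → Subgroup G) (L : Subgroup G) [L.Normal]
    (hL : ∀ x, ∀ l ∈ L, (∃ i ∈ J, (a i)⁻¹ * x ∈ H i) → ∃ i ∈ J, (a i)⁻¹ * (x * l) ∈ H i)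
    (hJ : SubnormalOrDerived J fun i => H i ⊔ L) :
    recipDivisorSum N {e | ∃ i ∈ J, (H i ⊔ L).index ∣ e} ≤
      (∑ i ∈ J, ((H i).index : ℝ)⁻¹) * recipDivisorSum N Set.univ := by
  classical
  have hsurj := QuotientGroup.mk'_surjective L
  have : Fintype (G ⧸ L) := Fintype.ofFinite _
  set U : Set G := {x | ∃ i ∈ J, (a i)⁻¹ * x ∈ H i} with hU
  have hmap : ∀ i, (H i ⊔ L).map (QuotientGroup.mk' L) = (H i).map (QuotientGroup.mk' L) :=
    fun i => by rw [Subgroup.map_sup, QuotientGroup.map_mk'_self, sup_bot_eq]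
  have hidx : ∀ i, ((H i).map (QuotientGroup.mk' L)).index = (H i ⊔ L).index := fun i => by
    rw [← hmap, Subgroup.index_map_eq _ hsurj (by rw [QuotientGroup.ker_mk']; exact le_sup_right)]
  set V : Set (G ⧸ L) :=
    {c | ∃ i ∈ J, ((a i : G) : G ⧸ L)⁻¹ * c ∈ (H i).map (QuotientGroup.mk' L)} with hV
  have h1 := card_mul_recipDivisorSum_le_card_iUnion_coset N J (fun i => (a i : G ⧸ L))
    (fun i => (H i).map (QuotientGroup.mk' L)) (by simpa only [hmap] using hJ.map hsurj)
  simp only [hidx] at h1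
  have h2 : Nat.card V * Nat.card L ≤ Nat.card U := by
    rw [L.card_eq_sum_card_out_mul U, Nat.card_eq_fintype_card (α := V),
      Fintype.card_of_subtype (Finset.univ.filter (· ∈ V)) (by simp), Finset.card_eq_sum_ones,
      Finset.sum_mul]
    refine (Finset.sum_le_sum fun c hc => ?_).trans
      (Finset.sum_le_sum_of_subset (Finset.filter_subset _ _))
    obtain ⟨i, hi, h, hh, hc⟩ := (Finset.mem_filter.1 hc).2
    have hcU : c.out ∈ U := by
      have hl : (a i * h)⁻¹ * c.out ∈ L := by
        refine QuotientGroup.eq.1 ?_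
        rw [QuotientGroup.out_eq', QuotientGroup.mk_mul]
        rw [QuotientGroup.mk'_apply] at hc
        rw [hc, mul_inv_cancel_left]
      have := hL (a i * h) _ hl ⟨i, hi, by simpa using hh⟩
      rwa [mul_inv_cancel_left] at this
    rw [one_mul]
    refine Nat.card_le_card_of_injective (fun l : L => ⟨l, hL _ _ l.2 hcU⟩) fun x y h => ?_
    simpa using h
  have h3 := card_iUnion_coset_le J a H
  have hLG : (Nat.card L : ℝ) * Nat.card (G ⧸ L) = Nat.card G := by
    exact_mod_cast L.card_mul_index
  have hGpos : (0 : ℝ) < Nat.card G := by exact_mod_cast Nat.card_pos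
  have hσ : 0 ≤ recipDivisorSum N Set.univ :=
    Finset.sum_nonneg fun _ _ => Set.indicator_nonneg (fun _ _ => by positivity) _
  refine le_of_mul_le_mul_left ?_ hGpos
  calc (Nat.card G : ℝ) * recipDivisorSum N {e | ∃ i ∈ J, (H i ⊔ L).index ∣ e}
      = Nat.card L * (Nat.card (G ⧸ L) *
          recipDivisorSum N {e | ∃ i ∈ J, (H i ⊔ L).index ∣ e}) := by rw [← hLG, mul_assoc]
    _ ≤ Nat.card L * (Nat.card V * recipDivisorSum N Set.univ) := by gcongr
    _ = ((Nat.card V * Nat.card L : ℕ) : ℝ) * recipDivisorSum N Set.univ := by push_cast; ring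
    _ ≤ Nat.card U * recipDivisorSum N Set.univ := by gcongr
    _ ≤ (Nat.card G * ∑ i ∈ J, ((H i).index : ℝ)⁻¹) * recipDivisorSum N Set.univ := by gcongr
    _ = _ := by ring

/-- If the union of the cosets `a i • H i` is stable under right multiplication by `L`, then it
is also the union of the cosets of the larger subgroups `H i ⊔ L`, whose indices govern the lower
bound. -/
theorem recipDivisorSum_le_sum_inv_index {ι G : Type*} [Group G] (N : ℕ)
    (J : Finset ι) (a : ι → G) (H : ι → Subgroup G) (hH : ∀ i ∈ J, (H i).FiniteIndex)
    (L : Subgroup G) [L.Normal] [L.FiniteIndex]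
    (hL : ∀ x, ∀ l ∈ L, (∃ i ∈ J, (a i)⁻¹ * x ∈ H i) → ∃ i ∈ J, (a i)⁻¹ * (x * l) ∈ H i)
    (hJ : SubnormalOrDerived J fun i => H i ⊔ L) :
    recipDivisorSum N {e | ∃ i ∈ J, (H i ⊔ L).index ∣ e} ≤
      (∑ i ∈ J, ((H i).index : ℝ)⁻¹) * recipDivisorSum N Set.univ := by
  -- Pass to the finite quotient by the core of the intersection of all subgroups involved.
  let K : Subgroup G := ⨅ i : J, (H i).normalCore
  have hKn : K.Normal := Subgroup.normal_iInf_normal fun i => inferInstance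
  have hKf : K.FiniteIndex := Subgroup.finiteIndex_iInf fun i =>
    have := hH i i.2
    inferInstance
  have hK : ∀ i ∈ J, K ≤ H i := fun i hi =>
    (iInf_le _ (⟨i, hi⟩ : J)).trans (Subgroup.normalCore_le _)
  set π := QuotientGroup.mk' K with hπ
  have hsurj : Function.Surjective π := QuotientGroup.mk'_surjective K
  have hker : π.ker = K := QuotientGroup.ker_mk' K
  have hmem : ∀ i ∈ J, ∀ x, π x ∈ (H i).map π ↔ x ∈ H i := fun i hi x => by
    rw [← Subgroup.mem_comap, Subgroup.comap_map_eq, hker, sup_eq_left.2 (hK i hi)]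
  have hidx : ∀ i ∈ J, ((H i).map π).index = (H i).index := fun i hi =>
    Subgroup.index_map_eq _ hsurj (hker.le.trans (hK i hi))
  have hidx' : ∀ i ∈ J, ((H i).map π ⊔ L.map π).index = (H i ⊔ L).index := fun i hi => by
    rw [← Subgroup.map_sup]
    exact Subgroup.index_map_eq _ hsurj (hker.le.trans ((hK i hi).trans le_sup_left))
  have hLn : (L.map π).Normal := Subgroup.Normal.map inferInstance π hsurj
  have h := recipDivisorSum_le_sum_inv_index_of_finite N J (fun i => π (a i))
    (fun i => (H i).map π) (L.map π) (fun y l' hl' ⟨i, hi, hy⟩ => by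
      obtain ⟨x, rfl⟩ := hsurj y
      obtain ⟨l, hl, rfl⟩ := hl'
      obtain ⟨j, hj, hxl⟩ := hL x l hl ⟨i, hi, (hmem i hi _).1 (by simpa using hy)⟩
      exact ⟨j, hj, by simpa using (hmem j hj _).2 hxl⟩)
    (by simpa only [Subgroup.map_sup] using hJ.map hsurj)
  rw [Finset.sum_congr rfl fun i hi => by rw [hidx i hi]] at h
  refine le_trans (recipDivisorSum_mono N ?_) h
  rintro e ⟨i, hi, he⟩
  exact ⟨i, hi, (hidx' i hi).symm ▸ he⟩

/-- In a uniform cover, the union of a subsystem of cosets is stable under right multiplication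
by any subgroup `L` contained in all the other subgroups: multiplication by `L` does not change
how often the complementary subsystem covers a point. -/
theorem IsUniformCover.exists_mem_mul {G : Type*} [Group G] {k : ℕ} {a : Fin k → G}
    {H : Fin k → Subgroup G} (h : IsUniformCover a H) (J : Finset (Fin k)) (L : Subgroup G)
    (hL : ∀ i ∉ J, L ≤ H i) (x l : G) (hl : l ∈ L) (hx : ∃ i ∈ J, (a i)⁻¹ * x ∈ H i) :
    ∃ i ∈ J, (a i)⁻¹ * (x * l) ∈ H i := by
  classical
  have hcount : ∀ y, coverCount a H y = (Finset.univ.filter fun i => (a i)⁻¹ * y ∈ H i).card := by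
    intro y
    rw [coverCount, Nat.card_eq_fintype_card, Fintype.card_of_subtype]
    intro i
    simp only [Finset.mem_filter, Finset.mem_univ, true_and]
    exact ⟨fun hy => ⟨_, hy, by simp⟩, by rintro ⟨g, hg, rfl⟩; simpa using hg⟩
  by_contra hne
  push Not at hne
  refine absurd (h (x * l) x) (ne_of_lt ?_)
  rw [hcount, hcount]
  obtain ⟨i, hi, hix⟩ := hx
  refine Finset.card_lt_card (Finset.ssubset_iff_of_subset ?_ |>.2
    ⟨i, by simpa using hix, by simpa using hne i hi⟩)
  intro j hj
  simp only [Finset.mem_filter, Finset.mem_univ, true_and] at hj ⊢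
  have hjJ : j ∉ J := fun hjJ => hne j hjJ hj
  have := (H j).mul_mem hj ((H j).inv_mem (hL j hjJ hl))
  simpa [mul_assoc] using this

/-! ### Evaluating reciprocal sums -/

theorem sum_inv_pow_eq {p : ℝ} (hp : 1 < p) (β n : ℕ) :
    ∑ b ∈ Finset.Ico β (β + n), (p ^ b)⁻¹ = (p ^ β)⁻¹ * ((1 - 1 / p ^ n) * (p / (p - 1))) := by
  have h0 : p ≠ 0 := by positivity
  have h1 : p - 1 ≠ 0 := by linarith
  induction n with
  | zero => simp
  | succ n ih =>
    rw [← add_assoc, Finset.sum_Ico_succ_top (by omega), ih, pow_add, pow_succ]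
    field_simp
    ring

theorem recipDivisorSum_univ_mul (N : ℕ) :
    recipDivisorSum N Set.univ * N = (∑ d ∈ N.divisors, d : ℕ) := by
  rcases Nat.eq_zero_or_pos N with rfl | hN
  · simp
  rw [← Nat.sum_div_divisors]
  simp only [recipDivisorSum, Set.indicator_univ]
  push_cast
  rw [Finset.sum_mul]
  refine Finset.sum_congr rfl fun d hd => ?_
  have hd' := Nat.dvd_of_mem_divisors hd
  have hd0 : (d : ℝ) ≠ 0 := Nat.cast_ne_zero.2 (Nat.pos_of_dvd_of_pos hd' hN).ne'
  rw [Nat.cast_div hd' hd0]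
  field_simp

theorem recipDivisorSum_univ_mul_of_coprime {m n : ℕ} (h : m.Coprime n) (hm : m ≠ 0)
    (hn : n ≠ 0) : recipDivisorSum (m * n) Set.univ =
      recipDivisorSum m Set.univ * recipDivisorSum n Set.univ := by
  have hm' : (m : ℝ) ≠ 0 := Nat.cast_ne_zero.2 hm
  have hn' : (n : ℝ) ≠ 0 := Nat.cast_ne_zero.2 hn
  refine mul_right_cancel₀ (mul_ne_zero hm' hn') ?_
  have h1 := recipDivisorSum_univ_mul (m * n)
  rw [h.sum_divisors_mul, Nat.cast_mul, Nat.cast_mul, ← recipDivisorSum_univ_mul m,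
    ← recipDivisorSum_univ_mul n] at h1
  rw [h1]
  ring

theorem recipDivisorSum_univ_prime_pow {p : ℕ} (hp : p.Prime) (n : ℕ) :
    recipDivisorSum (p ^ n) Set.univ =
      (1 - 1 / (p : ℝ) ^ (n + 1)) * ((p : ℝ) / ((p : ℝ) - 1)) := by
  have h := sum_inv_pow_eq (p := p) (by exact_mod_cast hp.one_lt) 0 (n + 1)
  simp only [recipDivisorSum, Set.indicator_univ]
  rw [Nat.sum_divisors_prime_pow hp]
  simpa using h

theorem recipDivisorSum_univ_prod_prime_pow (s : Finset ℕ) (p α : ℕ → ℕ)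
    (hp : ∀ t ∈ s, (p t).Prime) (hinj : Set.InjOn p s) :
    recipDivisorSum (∏ t ∈ s, p t ^ α t) Set.univ =
      (∏ t ∈ s, (1 - 1 / (p t : ℝ) ^ (α t + 1))) * ∏ t ∈ s, (p t : ℝ) / ((p t : ℝ) - 1) := by
  rw [← Finset.prod_mul_distrib]
  induction s using Finset.induction_on with
  | empty => simp [recipDivisorSum]
  | insert t s ht ih =>
    rw [Finset.prod_insert ht, Finset.prod_insert ht, recipDivisorSum_univ_mul_of_coprime,
      recipDivisorSum_univ_prime_pow (hp t (by simp)),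
      ih (fun u hu => hp u (by simp [hu])) (hinj.mono (by simp))]
    · refine Nat.Coprime.prod_right fun u hu => Nat.Coprime.pow _ _ ?_
      refine (Nat.coprime_primes (hp t (by simp)) (hp u (by simp [hu]))).2 fun h => ht ?_
      rwa [hinj (by simp) (by simp [hu]) h]
    · exact pow_ne_zero _ (hp t (by simp)).ne_zero
    · exact Finset.prod_ne_zero_iff.2 fun u hu => pow_ne_zero _ (hp u (by simp [hu])).ne_zero

/-- Splitting each `n i` into its `p`-part and its part prime to `p`, when no value of `n` is
taken more than `M` times. -/
theorem sum_inv_le_mul_sum_ordCompl {ι : Type*} (J : Finset ι) (n : ι → ℕ) {p : ℕ}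
    (β α M : ℕ)
    (hβ : ∀ i ∈ J, β ≤ (n i).factorization p) (hα : ∀ i ∈ J, (n i).factorization p ≤ α)
    (hM : ∀ j ∈ J, (J.filter fun i => n i = n j).card ≤ M) :
    ∑ i ∈ J, (n i : ℝ)⁻¹ ≤
      M * ((∑ d ∈ J.image (fun i => ordCompl[p] (n i)), (d : ℝ)⁻¹) *
        ∑ b ∈ Finset.Ico β (α + 1), ((p : ℝ) ^ b)⁻¹) := by
  classical
  rw [Finset.sum_comp (fun v : ℕ => (v : ℝ)⁻¹) n]
  calc ∑ v ∈ J.image n, (J.filter fun i => n i = v).card • (v : ℝ)⁻¹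
      ≤ ∑ v ∈ J.image n, (M : ℝ) * (v : ℝ)⁻¹ := by
        refine Finset.sum_le_sum fun v hv => ?_
        obtain ⟨j, hj, rfl⟩ := Finset.mem_image.1 hv
        rw [nsmul_eq_mul]
        have := hM j hj
        gcongr
    _ = M * ∑ v ∈ J.image n, (v : ℝ)⁻¹ := (Finset.mul_sum _ _ _).symm
    _ ≤ _ := by
        refine mul_le_mul_of_nonneg_left ?_ (by positivity)
        rw [Finset.sum_mul_sum, ← Finset.sum_product']
        let φ : ℕ → ℕ × ℕ := fun v => (ordCompl[p] v, v.factorization p)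
        have hφ : ∀ v, p ^ (φ v).2 * (φ v).1 = v := fun v => Nat.ordProj_mul_ordCompl_eq_self v p
        have hinj : Function.Injective φ := fun v w h => by rw [← hφ v, ← hφ w, h]
        calc ∑ v ∈ J.image n, (v : ℝ)⁻¹
            = ∑ x ∈ (J.image n).image φ, (x.1 : ℝ)⁻¹ * ((p : ℝ) ^ x.2)⁻¹ := by
              rw [Finset.sum_image hinj.injOn]
              refine Finset.sum_congr rfl fun v _ => ?_
              conv_lhs => rw [← hφ v]
              push_cast
              rw [mul_inv, mul_comm]
          _ ≤ _ := by
              refine Finset.sum_le_sum_of_subset_of_nonneg ?_ fun _ _ _ => by positivity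
              intro x hx
              simp only [Finset.mem_image, exists_exists_and_eq_and] at hx
              obtain ⟨i, hi, rfl⟩ := hx
              exact Finset.mem_product.2 ⟨Finset.mem_image_of_mem _ hi, Finset.mem_Ico.2
                ⟨hβ i hi, Nat.lt_succ_of_le (hα i hi)⟩⟩

/-! ### Uniform covers -/

/-- The bound for uniform covers, before the two reciprocal sums are evaluated: any normal `L` of
index prime to `p` inside the subgroups of index prime to `p` will do. -/
theorem one_le_of_isUniformCover {G : Type*} [Group G] {k : ℕ} {a : Fin k → G}
    {H : Fin k → Subgroup G} (hcover : IsUniformCover a H) (hfin : ∀ i, (H i).FiniteIndex)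
    {p : ℕ} (hp : p.Prime) (hne : ∃ i, p ∣ (H i).index) (L : Subgroup G) [L.Normal]
    (hLp : ¬ p ∣ L.index) (hLH : ∀ i, ¬ p ∣ (H i).index → L ≤ H i)
    (hJ : SubnormalOrDerived (Finset.univ.filter fun i => p ∣ (H i).index) fun i => H i ⊔ L)
    (N β α M : ℕ) (hN : N ≠ 0) (hdvd : ∀ i, p ∣ (H i).index → ordCompl[p] (H i).index ∣ N)
    (hβ : ∀ i, p ∣ (H i).index → β ≤ (H i).index.factorization p)
    (hα : ∀ i, p ∣ (H i).index → (H i).index.factorization p ≤ α)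
    (hM : ∀ j, p ∣ (H j).index → Nat.card {i : Fin k // (H i).index = (H j).index} ≤ M) :
    1 ≤ M * (∑ b ∈ Finset.Ico β (α + 1), ((p : ℝ) ^ b)⁻¹) * recipDivisorSum N Set.univ := by
  classical
  set J : Finset (Fin k) := Finset.univ.filter fun i => p ∣ (H i).index with hJdef
  have hmem : ∀ i, i ∈ J ↔ p ∣ (H i).index := fun i => by simp [hJdef]
  have hLf : L.FiniteIndex := ⟨fun h => hLp (h ▸ dvd_zero p)⟩
  have h0 : ∀ i, (H i).index ≠ 0 := fun i => (hfin i).index_ne_zero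
  set D : Finset ℕ := J.image fun i => ordCompl[p] (H i).index with hD
  have h1 := recipDivisorSum_le_sum_inv_index N J a H (fun i _ => hfin i) L
    (fun x l hl => hcover.exists_mem_mul J L
      (fun i hi => hLH i fun h => hi ((hmem i).2 h)) x l hl) hJ
  have h2 : ∑ d ∈ D, (d : ℝ)⁻¹ ≤ recipDivisorSum N {e | ∃ i ∈ J, (H i ⊔ L).index ∣ e} := by
    rw [recipDivisorSum_eq_sum_filter]
    refine Finset.sum_le_sum_of_subset_of_nonneg (fun d hd => ?_) fun _ _ _ => by positivity
    obtain ⟨i, hi, rfl⟩ := Finset.mem_image.1 hd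
    refine Finset.mem_filter.2 ⟨Nat.mem_divisors.2 ⟨hdvd i ((hmem i).1 hi), hN⟩, i, hi, ?_⟩
    -- The index of `H i ⊔ L` divides that of `H i` and, like that of `L`, is prime to `p`.
    refine Nat.Coprime.dvd_of_dvd_mul_left (m := p ^ (H i).index.factorization p) ?_ ?_
    · refine Nat.Coprime.pow_right _ (hp.coprime_iff_not_dvd.2 fun h => hLp ?_).symm
      exact h.trans (Subgroup.index_dvd_of_le le_sup_right)
    · rw [Nat.ordProj_mul_ordCompl_eq_self]
      exact Subgroup.index_dvd_of_le le_sup_left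
  have h3 := sum_inv_le_mul_sum_ordCompl J (fun i => (H i).index) (p := p) β α M
    (fun i hi => hβ i ((hmem i).1 hi)) (fun i hi => hα i ((hmem i).1 hi)) (fun j hj => by
      refine le_trans ?_ (hM j ((hmem j).1 hj))
      rw [Nat.card_eq_fintype_card, Fintype.card_subtype]
      exact Finset.card_le_card (Finset.filter_subset_filter _ (Finset.subset_univ _)))
  have hDpos : 0 < ∑ d ∈ D, (d : ℝ)⁻¹ := by
    refine Finset.sum_pos (fun d hd => ?_) ?_
    · obtain ⟨i, -, rfl⟩ := Finset.mem_image.1 hd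
      exact inv_pos.2 (Nat.cast_pos.2 (Nat.ordCompl_pos p (h0 i)))
    · obtain ⟨i, hi⟩ := hne
      exact ⟨_, Finset.mem_image_of_mem _ ((hmem i).2 hi)⟩
  have hσ : 0 ≤ recipDivisorSum N Set.univ :=
    Finset.sum_nonneg fun _ _ => Set.indicator_nonneg (fun _ _ => by positivity) _
  refine le_of_mul_le_mul_left ?_ hDpos
  calc (∑ d ∈ D, (d : ℝ)⁻¹) * 1 ≤ (∑ i ∈ J, ((H i).index : ℝ)⁻¹) * recipDivisorSum N Set.univ := by
        rw [mul_one]; exact h2.trans h1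
    _ ≤ _ := mul_le_mul_of_nonneg_right h3 hσ
    _ = _ := by ring

/-- The intersection of the cores of the subgroups whose index is prime to `p`. -/
def primeToCore {G ι : Type*} [Group G] (p : ℕ) (H : ι → Subgroup G) : Subgroup G :=
  ⨅ i : {i // ¬ p ∣ (H i).index}, (H i).normalCore

theorem primeToCore_normal {G ι : Type*} [Group G] (p : ℕ) (H : ι → Subgroup G) :
    (primeToCore p H).Normal :=
  Subgroup.normal_iInf_normal fun _ => inferInstance

theorem primeToCore_le {G ι : Type*} [Group G] {p : ℕ} {H : ι → Subgroup G} {i : ι}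
    (hi : ¬ p ∣ (H i).index) : primeToCore p H ≤ H i :=
  (iInf_le _ (⟨i, hi⟩ : {i // ¬ p ∣ (H i).index})).trans (Subgroup.normalCore_le _)

theorem not_dvd_index_primeToCore {G ι : Type*} [Group G] [Finite ι] {p : ℕ} (hp : p.Prime)
    {H : ι → Subgroup G} (hfin : ∀ i, (H i).FiniteIndex)
    (hsylow : ∀ i, p < (H i).index → ¬ p ∣ (H i).index → ¬ (H i).IsSubnormal →
      HasNormalSylow p (G ⧸ (H i).normalCore)) : ¬ p ∣ (primeToCore p H).index := by
  refine Subgroup.not_dvd_index_iInf hp _ (fun _ => inferInstance) fun ⟨i, hi⟩ => ?_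
  have := hfin i
  by_cases hs : (H i).IsSubnormal
  · exact hs.not_dvd_index_normalCore hp hi
  rcases lt_trichotomy (H i).index p with h | h | h
  · exact Subgroup.not_dvd_index_normalCore_of_index_lt hp h
  · exact absurd h.symm.dvd hi
  · exact (hsylow i h hi hs).not_dvd_index_normalCore hp (Subgroup.normalCore_le _) hi

theorem subnormalOrDerived_sup_primeToCore {G : Type*} [Group G] {k p : ℕ}
    (H : Fin k → Subgroup G)
    (h : (¬ ∀ i, p ∣ (H i).index → (H i).IsSubnormal) →
      (∀ i, p ∣ (H i).index → Group.IsSolvable (G ⧸ (H i).normalCore)) ∨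
      (∀ i, ¬ p ∣ (H i).index → Group.IsSolvable (G ⧸ (H i).normalCore))) :
    SubnormalOrDerived (Finset.univ.filter fun i => p ∣ (H i).index)
      fun i => H i ⊔ primeToCore p H := by
  have := primeToCore_normal p H
  by_cases hs : ∀ i, p ∣ (H i).index → (H i).IsSubnormal
  · exact Or.inl fun i hi => (hs i (Finset.mem_filter.1 hi).2).sup_normal _
  right
  rcases h hs with h | h
  · obtain ⟨n, hn⟩ := exists_forall_derivedSeries_le (fun i => p ∣ (H i).index)
      (fun i => (H i).normalCore) fun i hi => (h i hi).exists_derivedSeries_le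
    exact ⟨n, fun i hi => ((hn i (Finset.mem_filter.1 hi).2).trans
      (Subgroup.normalCore_le _)).trans le_sup_left⟩
  · obtain ⟨n, hn⟩ := exists_forall_derivedSeries_le (fun i => ¬ p ∣ (H i).index)
      (fun i => (H i).normalCore) fun i hi => (h i hi).exists_derivedSeries_le
    exact ⟨n, fun i _ => (le_iInf fun j : {i // ¬ p ∣ (H i).index} => hn j j.2).trans le_sup_right⟩

/-- If the quotient by the common core has a normal Sylow `q`-subgroup and order divisible by `q`,
then `q` divides an index, since otherwise that Sylow subgroup would lie in all the `H i`. -/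
theorem HasNormalSylow.exists_dvd_index {G ι : Type*} [Group G] {q : ℕ} (hq : q.Prime)
    {H : ι → Subgroup G} [(⨅ i, H i).normalCore.FiniteIndex]
    (h : HasNormalSylow q (G ⧸ (⨅ i, H i).normalCore))
    (hd : q ∣ Nat.card (G ⧸ (⨅ i, H i).normalCore)) : ∃ i, q ∣ (H i).index := by
  by_contra! hne
  obtain ⟨P, hPn, hPq, hP⟩ := h.exists_normal hq
  refine hPq (Dvd.dvd.trans hd (Subgroup.index_dvd_of_le (Subgroup.normal_le_normalCore.2 ?_)))
  exact le_iInf fun i => hP _ ((Subgroup.normalCore_le _).trans (iInf_le _ i)) (hne i)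

theorem theorem4p1 {G : Type*} [Group G] {k : ℕ}
    (a : Fin k → G) (H : Fin k → Subgroup G)
    (hcover : IsNontrivialUniformCover a H)
    (r : ℕ) (p α : ℕ → ℕ)
    (hprime : ∀ t ∈ Finset.Icc 1 r, (p t).Prime)
    (hdistinct : Set.InjOn p (Set.Icc 1 r))
    (hα : ∀ t ∈ Finset.Icc 1 r, 1 ≤ α t)
    (hlcm : Finset.univ.lcm (fun i => (H i).index) = ∏ t ∈ Finset.Icc 1 r, p t ^ α t)
    (β : ℕ)
    (hβ : IsLeast {b : ℕ | 1 ≤ b ∧ b ≤ α r ∧ ∃ i, b = padicValNat (p r) (H i).index} β)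
    (ε : ℝ)
    (hε : ε = (1 - 1 / (p r : ℝ) ^ (α r - β + 1)) *
      ∏ t ∈ Finset.Ioo 0 r, (1 - 1 / (p t : ℝ) ^ (α t + 1)))
    (M : ℕ)
    (hM : IsGreatest {m : ℕ | ∃ j, p r ∣ (H j).index ∧
      m = Nat.card {i : Fin k // (H i).index = (H j).index}} M)
    (hcond :
      -- the subnormality and solvability conditions on the individual subgroups
      (((¬ ∀ i, p r ∣ (H i).index → (H i).IsSubnormal) →
          (∀ i, p r ∣ (H i).index → Group.IsSolvable (G ⧸ (H i).normalCore)) ∨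
          (∀ i, ¬ p r ∣ (H i).index → Group.IsSolvable (G ⧸ (H i).normalCore))) ∧
        (∀ i, p r < (H i).index → ¬ p r ∣ (H i).index → ¬ (H i).IsSubnormal →
          HasNormalSylow (p r) (G ⧸ (H i).normalCore))) ∨
      -- the condition on the quotient by the common core, with the primes in increasing order
      (StrictMonoOn p (Set.Icc 1 r) ∧
        Group.IsSolvable (G ⧸ (⨅ i, H i).normalCore) ∧
        ∃ q : ℕ, IsGreatest {l : ℕ | l.Prime ∧ l ∣ Nat.card (G ⧸ (⨅ i, H i).normalCore)} q ∧
          HasNormalSylow q (G ⧸ (⨅ i, H i).normalCore))) :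
    (p r : ℝ) ^ β ≤ ε * M * ∏ t ∈ Finset.Icc 1 r, (p t : ℝ) / ((p t : ℝ) - 1) := by
  have hdvd_lcm : ∀ i, (H i).index ∣ ∏ t ∈ Finset.Icc 1 r, p t ^ α t := fun i =>
    hlcm ▸ Finset.dvd_lcm (Finset.mem_univ i)
  have hprod0 : ∏ t ∈ Finset.Icc 1 r, p t ^ α t ≠ 0 :=
    Finset.prod_ne_zero_iff.2 fun t ht => pow_ne_zero _ (hprime t ht).ne_zero
  have h0 : ∀ i, (H i).index ≠ 0 := fun i h =>
    hprod0 (Nat.eq_zero_of_zero_dvd (h ▸ hdvd_lcm i))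
  have hfin : ∀ i, (H i).FiniteIndex := fun i => ⟨h0 i⟩
  obtain hr | hr : r = 0 ∨ 1 ≤ r := by omega
  -- For `r = 0` all indices divide `1`, so the cover is trivial.
  · subst hr
    refine absurd (fun i => ?_) hcover.2
    exact Subgroup.index_eq_one.1 (Nat.dvd_one.1 (by simpa using hdvd_lcm i))
  have hrmem : r ∈ Finset.Icc 1 r := Finset.mem_Icc.2 ⟨hr, le_rfl⟩
  have hp : (p r).Prime := hprime r hrmem
  have hsplit : Finset.Icc 1 r = insert r (Finset.Ioo 0 r) := by
    ext t
    simp only [Finset.mem_Icc, Finset.mem_insert, Finset.mem_Ioo]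
    omega
  have hsub : ∀ t ∈ Finset.Ioo 0 r, t ∈ Finset.Icc 1 r := fun t ht => by
    rw [hsplit]; exact Finset.mem_insert_of_mem ht
  have hrnot : r ∉ Finset.Ioo 0 r := by simp
  set N := ∏ t ∈ Finset.Ioo 0 r, p t ^ α t with hN
  have hNprod : ∏ t ∈ Finset.Icc 1 r, p t ^ α t = p r ^ α r * N := by
    rw [hsplit, Finset.prod_insert hrnot]
  have hN0 : N ≠ 0 := fun h => hprod0 (by rw [hNprod, h, mul_zero])
  have hpN : ¬ p r ∣ N := by
    intro h
    obtain ⟨t, ht, htd⟩ := (hp.prime.dvd_finsetProd_iff _).1 h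
    have heq := (Nat.prime_dvd_prime_iff_eq hp (hprime t (hsub t ht))).1 (hp.dvd_of_dvd_pow htd)
    have := hdistinct (by simpa using hrmem) (by simpa using hsub t ht) heq
    exact hrnot (this ▸ ht)
  have hfact : ∀ i, (H i).index.factorization (p r) ≤ α r := fun i => by
    have h1 := (Nat.factorization_le_iff_dvd (h0 i) hprod0).2 (hdvd_lcm i) (p r)
    rw [hNprod, Nat.factorization_mul (pow_ne_zero _ hp.ne_zero) hN0] at h1
    simpa [hp.factorization_self, Nat.factorization_eq_zero_of_not_dvd hpN] using h1
  have hdvdN : ∀ i, ordCompl[p r] (H i).index ∣ N := fun i => by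
    refine Nat.Coprime.dvd_of_dvd_mul_left (m := p r ^ α r) ?_ ?_
    · exact Nat.Coprime.pow_right _ (Nat.coprime_ordCompl hp (h0 i)).symm
    · exact hNprod ▸ (Nat.ordCompl_dvd _ _).trans (hdvd_lcm i)
  obtain ⟨⟨hβ1, hβα, i₀, hi₀⟩, hβmin⟩ := hβ
  have hne : p r ∣ (H i₀).index := dvd_of_one_le_padicValNat (hi₀ ▸ hβ1)
  have hβle : ∀ i, p r ∣ (H i).index → β ≤ (H i).index.factorization (p r) := fun i hi =>
    hβmin ⟨hp.factorization_pos_of_dvd (h0 i) hi, hfact i, i, Nat.factorization_def _ hp⟩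
  -- The condition on the quotient by the common core implies the other two.
  have hcond' : ((¬ ∀ i, p r ∣ (H i).index → (H i).IsSubnormal) →
      (∀ i, p r ∣ (H i).index → Group.IsSolvable (G ⧸ (H i).normalCore)) ∨
      (∀ i, ¬ p r ∣ (H i).index → Group.IsSolvable (G ⧸ (H i).normalCore))) ∧
      ¬ p r ∣ (primeToCore (p r) H).index := by
    rcases hcond with ⟨h1, h2⟩ | ⟨hmono, hsolv, q, ⟨⟨hq, hqd⟩, hqmax⟩, hsyl⟩
    · exact ⟨h1, not_dvd_index_primeToCore hp hfin h2⟩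
    have hfi : (⨅ i, H i).FiniteIndex := Subgroup.finiteIndex_iInf hfin
    obtain ⟨j, hj⟩ := hsyl.exists_dvd_index hq hqd
    -- Both `q` and `p r` are the largest prime dividing an index.
    have hqr : q = p r := by
      refine le_antisymm ?_ (hqmax ⟨hp, hne.trans ?_⟩)
      · obtain ⟨t, ht, htd⟩ := (hq.prime.dvd_finsetProd_iff _).1 (hj.trans (hdvd_lcm j))
        rw [(Nat.prime_dvd_prime_iff_eq hq (hprime t ht)).1 (hq.dvd_of_dvd_pow htd)]
        exact hmono.monotoneOn (by simpa using ht) (by simpa using hrmem) (Finset.mem_Icc.1 ht).2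
      · exact Subgroup.index_dvd_of_le ((Subgroup.normalCore_le _).trans (iInf_le _ i₀))
    have hle : ∀ i, (⨅ i, H i).normalCore ≤ H i := fun i =>
      (Subgroup.normalCore_le _).trans (iInf_le _ i)
    refine ⟨fun _ => Or.inl fun i _ => ?_, ?_⟩
    · exact Group.isSolvable_of_surjective
        (f := QuotientGroup.map _ _ (MonoidHom.id G)
          (Subgroup.normal_le_normalCore.2 (hle i) : (⨅ i, H i).normalCore ≤ (H i).normalCore))
        (QuotientGroup.map_surjective_of_surjective _ _ _ (QuotientGroup.mk_surjective) _)
    · refine Subgroup.not_dvd_index_iInf hp _ (fun _ => inferInstance) fun ⟨i, hi⟩ => ?_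
      exact (hqr ▸ hsyl).not_dvd_index_normalCore hp (hle i) hi
  have := primeToCore_normal (p r) H
  have key := one_le_of_isUniformCover hcover.1 hfin hp ⟨i₀, hne⟩ (primeToCore (p r) H)
    hcond'.2 (fun i => primeToCore_le) (subnormalOrDerived_sup_primeToCore H hcond'.1)
    N β (α r) M hN0 (fun i _ => hdvdN i) hβle (fun i _ => hfact i) (fun j hj => hM.2 ⟨j, hj, rfl⟩)
  have hp1 : (1 : ℝ) < p r := by exact_mod_cast hp.one_lt
  rw [show α r + 1 = β + (α r - β + 1) by omega, sum_inv_pow_eq hp1,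
    recipDivisorSum_univ_prod_prime_pow _ p α (fun t ht => hprime t (hsub t ht))
      (hdistinct.mono fun t ht => by simpa using hsub t ht)] at key
  rw [hε, hsplit, Finset.prod_insert hrnot]
  have hpβ : (0 : ℝ) < (p r : ℝ) ^ β := by positivity
  calc (p r : ℝ) ^ β = (p r : ℝ) ^ β * 1 := (mul_one _).symm
    _ ≤ _ := mul_le_mul_of_nonneg_left key hpβ.le
    _ = _ := by field_simp
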